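/- Let $\omega=\{0,1,2,\dots\}$, let $c,h\in\omega^\omega$ with $c(i)\ge 1$ for all $i$ and $h(i)\ge 1$ for all but finitely many $i$, and identify $c(i)$ with the set $\{0,\dots,c(i)-1\}$. Let $\prod c:=\prod_{i<\omega}c(i)$ and let $\mathcal S(c,h)$ be the set of all sequences $\varphi=\langle\varphi(i)\mid i<\omega\rangle$ with $\varphi(i)\subseteq c(i)$ and $|\varphi(i)|\le h(i)$ for all $i$. For $y\in\prod c$ and $\varphi\in\mathcal S(c,h)$ write $y\notin^\infty\varphi$ if $y(i)\notin\varphi(i)$ for all but finitely many $i$. Put $$\mathfrak v^\exists_{c,h}:=\min\{|E| : E\subseteq\textstyle\prod c,\ \forall\varphi\in\mathcal S(c,h)\ \exists y\in E:\ y\notin^\infty\varphi\},$$ $$\mathfrak c^\exists_{c,h}:=\min\{|R| : R\subseteq\mathcal S(c,h),\ \neg\exists y\in\textstyle\prod c\ \forall\varphi\in R:\ y\notin^\infty\varphi\},$$ where $\min\emptyset:=\infty$, which is larger than every cardinal. Let $\mathcal N$ be the ideal of subsets of $2^\omega$ of Lebesgue (i.e. fair coin tossing) measure zero, let $\operatorname{cov}(\mathcal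 N)$ be the least size of a subfamily of $\mathcal N$ whose union is $2^\omega$, and let $\operatorname{non}(\mathcal N)$ be the least size of a subset of $2^\omega$ that is not in $\mathcal N$. A relational system is a triple $\mathbf R=\langle X,Y,\sqsubset\rangle$ with ${\sqsubset}\subseteq X\times Y$; its dual is $\mathbf R^\perp:=\langle Y,X,\sqsubset^\perp\rangle$, where $y\sqsubset^\perp x$ means that $x\sqsubset y$ fails. Write $\mathbf R\preceq_T\mathbf R'=\langle X',Y',\sqsubset'\rangle$ if there are maps $F:X\to X'$ and $G:Y'\to Y$ such that, for all $x\in X$ and $y'\in Y'$, $F(x)\sqsubset' y'$ implies $x\sqsubset G(y')$. Let $\mathbf{Cv}(\mathcal N):=\langle 2^\omega,\mathcal N,\in\rangle$, and let $\mathbf{aLc}(c,h):=\langle\mathcal S(c,h),\prod c,\sqsubset\rangle$, where $\varphi\sqsubset y$ means $y\notin^\infty\varphi$. (a) If $\sum_{i<\omega}\frac{h(i)}{c(i)}<\infty$, then $\mathbf{Cv}(\mathcal N)\preceq_T\mathbf{aLc}(c,h)^\perp$; moreover $\operatorname{cov}(\mathcal N)\le\mathfrak c^\exists_{c,h}$ and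 $\mathfrak v^\exists_{c,h}\le\operatorname{non}(\mathcal N)$. (b) If $\sum_{i<\omega}\frac{h(i)}{c(i)}=\infty$, then $\mathbf{Cv}(\mathcal N)\preceq_T\mathbf{aLc}(c,h)$; moreover $\operatorname{cov}(\mathcal N)\le\mathfrak v^\exists_{c,h}$ and $\mathfrak c^\exists_{c,h}\le\operatorname{non}(\mathcal N)$. -/

import Mathlib

open Filter MeasureTheory
open scoped ENNReal Cardinal

universe u v

noncomputable section

/-- A relational system `⟨X, Y, ⊏⟩`. -/
structure RelSystem where
  X : Type u
  Y : Type u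
  rel : X → Y → Prop

namespace RelSystem

/-- The dual relational system `R^⊥ = ⟨Y, X, R'⟩`, where `R' y x` says that `x ⊏ y` fails. -/
def dual (R : RelSystem.{u}) : RelSystem.{u} where
  X := R.Y
  Y := R.X
  rel y x := ¬ R.rel x y

/-- `(F, G)` is a Tukey connection from `R` to `R'`. -/
def IsTukeyConnection (R : RelSystem.{u}) (R' : RelSystem.{v}) (F : R.X → R'.X) (G : R'.Y → R.Y) :
    Prop :=
  ∀ (x : R.X) (y' : R'.Y), R'.rel (F x) y' → R.rel x (G y')

/-- `R` is Tukey-below `R'`. -/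
def TukeyLE (R : RelSystem.{u}) (R' : RelSystem.{v}) : Prop :=
  ∃ (F : R.X → R'.X) (G : R'.Y → R.Y), IsTukeyConnection R R' F G

end RelSystem

/-- The least cardinality of a set with property `P`, with the convention `min ∅ = ∞`. -/
def minCard {α : Type u} (P : Set α → Prop) : WithTop Cardinal.{u} :=
  sInf {κ | ∃ S : Set α, P S ∧ κ = ((#S : Cardinal.{u}) : WithTop Cardinal.{u})}

/-- `Cv(I) = ⟨X, I, ∈⟩` for a family `I` of subsets of `X`. -/
def Cv {X : Type u} (I : Set (Set X)) : RelSystem.{u} where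
  X := X
  Y := I
  rel x A := x ∈ A.1

/-- The covering number: the least size of a subfamily of `I` that covers `X`. -/
def covNum {X : Type u} (I : Set (Set X)) : WithTop Cardinal.{u} :=
  minCard fun F : Set (Set X) => F ⊆ I ∧ ⋃₀ F = Set.univ

/-- The uniformity number: the least size of a subset of `X` that is not in `I`. -/
def nonNum {X : Type u} (I : Set (Set X)) : WithTop Cardinal.{u} :=
  minCard fun A : Set X => A ∉ I

/-- Lebesgue (fair coin tossing) measure on `2^ω`. -/
def cantorMeasure : Measure (ℕ → Bool) :=
  Measure.infinitePi fun _ => (PMF.uniformOfFintype Bool).toMeasure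

/-- The ideal `𝒩` of measure zero subsets of `2^ω`; the sets need not be measurable
(a `Measure` is applied to arbitrary sets as an outer measure). -/
def nullIdeal : Set (Set (ℕ → Bool)) :=
  {A | cantorMeasure A = 0}

/-- `S(C, h)`: the `h`-slaloms, i.e. sequences of subsets of `C i` of size at most `h i`. -/
def Slalom (C : ℕ → Type u) (h : ℕ → ℕ) : Type u :=
  ∀ i, {s : Finset (C i) // s.card ≤ h i}

/-- `φ` anti-localises `y`: for all but finitely many `i`, `y i ∉ φ i`. -/
def AntiLocalises {C : ℕ → Type u} {h : ℕ → ℕ} (φ : Slalom C h) (y : ∀ i, C i) : Prop :=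
  ∀ᶠ i in atTop, y i ∉ (φ i).1

/-- `aLc(C, h)`: the slaloms against `∏ C`, with the anti-localisation relation. -/
def aLc (C : ℕ → Type u) (h : ℕ → ℕ) : RelSystem.{u} where
  X := Slalom C h
  Y := ∀ i, C i
  rel φ y := AntiLocalises φ y

/-- The anti-localisation cardinal `𝔳^∃_{C,h}`. -/
def vExists (C : ℕ → Type u) (h : ℕ → ℕ) : WithTop Cardinal.{u} :=
  minCard fun E : Set (∀ i, C i) => ∀ φ : Slalom C h, ∃ y ∈ E, AntiLocalises φ y

/-- The anti-localisation cardinal `𝔠^∃_{C,h}`. -/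
def cExists (C : ℕ → Type u) (h : ℕ → ℕ) : WithTop Cardinal.{u} :=
  minCard fun R : Set (Slalom C h) => ¬ ∃ y : ∀ i, C i, ∀ φ ∈ R, AntiLocalises φ y

/-- For `c ∈ ω^ω`, the sequence of sets `c(i) = {0, …, c(i) - 1}`. -/
abbrev finSeq (c : ℕ → ℕ) : ℕ → Type :=
  fun i => Fin (c i)

end

/-! Distribute the coin tosses `x ∈ 2^ω` into disjoint finite blocks `x⁰, x¹, …`, which are
independent and uniformly distributed.

If `∑ h i / |C i| < ∞`, let the block `xⁱ` pick a point of `C i` nearly uniformly (or of a large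
finite subset, if `C i` is infinite). A fixed slalom `φ` catches that point with probability at most
about `h i / |C i|`, so by the first Borel–Cantelli lemma almost no `x` has its points caught
infinitely often.

If `∑ h i / |C i| = ∞`, let the block `xⁱ` pick nearly uniformly among `|C i|` subsets of size
`min (h i) |C i|` that cover every point of `C i` equally often. They catch a fixed `y i` with
probability at least about `min 1 (h i / |C i|)`, so by the second Borel–Cantelli lemma almost all
`x` catch `y` infinitely often.

The inequalities between the cardinals hold because a Tukey connection maps witnesses for the
dominating and bounding numbers to such witnesses. -/

open ProbabilityTheory

theorem minCard_le {α : Type u} {P : Set α → Prop} {S : Set α} (hS : P S) :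
    minCard P ≤ ((#S : Cardinal.{u}) : WithTop Cardinal.{u}) :=
  sInf_le ⟨S, hS, rfl⟩

theorem minCard_le_minCard_of_image {α β : Type u} {P : Set α → Prop} {Q : Set β → Prop}
    (f : α → β) (hf : ∀ S, P S → Q (f '' S)) : minCard Q ≤ minCard P := by
  refine le_sInf ?_
  rintro _ ⟨S, hS, rfl⟩
  exact (minCard_le (hf S hS)).trans (WithTop.coe_le_coe.2 Cardinal.mk_image_le)

namespace RelSystem

/-- The dominating number `𝔡(R)`: the least size of a set of responses that meets every
challenge. -/
noncomputable def dominatingNum (R : RelSystem.{u}) : WithTop Cardinal.{u} :=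
  minCard fun D : Set R.Y => ∀ x, ∃ y ∈ D, R.rel x y

/-- The bounding number `𝔟(R)`: the least size of a set of challenges that no single response
meets. -/
noncomputable def boundingNum (R : RelSystem.{u}) : WithTop Cardinal.{u} :=
  minCard fun B : Set R.X => ¬ ∃ y, ∀ x ∈ B, R.rel x y

theorem dominatingNum_dual (R : RelSystem.{u}) : R.dual.dominatingNum = R.boundingNum := by
  simp only [boundingNum, not_exists, not_forall, exists_prop]
  rfl

theorem boundingNum_dual (R : RelSystem.{u}) : R.dual.boundingNum = R.dominatingNum := by
  simp only [boundingNum, dual, not_exists, not_forall, exists_prop, not_not]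
  rfl

variable {R R' : RelSystem.{u}}

theorem TukeyLE.dominatingNum_le (hRR' : TukeyLE R R') : R.dominatingNum ≤ R'.dominatingNum := by
  obtain ⟨F, G, hFG⟩ := hRR'
  refine minCard_le_minCard_of_image G fun D hD x => ?_
  obtain ⟨y, hyD, hy⟩ := hD (F x)
  exact ⟨G y, Set.mem_image_of_mem G hyD, hFG x y hy⟩

theorem TukeyLE.boundingNum_le (hRR' : TukeyLE R R') : R'.boundingNum ≤ R.boundingNum := by
  obtain ⟨F, G, hFG⟩ := hRR'
  refine minCard_le_minCard_of_image F fun B hB => ?_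
  rintro ⟨y, hy⟩
  exact hB ⟨G y, fun x hx => hFG x y (hy (F x) (Set.mem_image_of_mem F hx))⟩

end RelSystem

section Cv

variable {X : Type u} (I : Set (Set X))

theorem dominatingNum_cv : (Cv I).dominatingNum = covNum I := by
  refine le_antisymm (le_sInf ?_) (minCard_le_minCard_of_image Subtype.val fun D hD => ⟨?_, ?_⟩)
  · rintro _ ⟨F, ⟨hFI, hF⟩, rfl⟩
    refine (minCard_le (S := (Subtype.val ⁻¹' F : Set I)) fun x => ?_).trans
      (WithTop.coe_le_coe.2 (Cardinal.mk_preimage_of_injective _ F Subtype.val_injective))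
    obtain ⟨A, hAF, hxA⟩ := Set.mem_sUnion.1 (hF ▸ Set.mem_univ x)
    exact ⟨⟨A, hFI hAF⟩, hAF, hxA⟩
  · rintro _ ⟨A, -, rfl⟩
    exact A.2
  · refine Set.eq_univ_of_forall fun x => ?_
    obtain ⟨A, hAD, hxA⟩ := hD x
    exact ⟨A.1, Set.mem_image_of_mem _ hAD, hxA⟩

variable {I}

theorem boundingNum_cv (hI : IsLowerSet I) : (Cv I).boundingNum = nonNum I := by
  refine congrArg minCard (funext fun B => propext (not_congr ⟨fun hB => ?_, fun hB => ?_⟩))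
  · obtain ⟨A, hBA⟩ := hB
    exact hI hBA A.2
  · exact ⟨⟨B, hB⟩, fun _ => id⟩

theorem RelSystem.TukeyLE.covNum_le_and_le_nonNum (hI : IsLowerSet I) {R : RelSystem.{u}}
    (hR : RelSystem.TukeyLE (Cv I) R) : covNum I ≤ R.dominatingNum ∧ R.boundingNum ≤ nonNum I :=
  ⟨dominatingNum_cv I ▸ hR.dominatingNum_le, boundingNum_cv hI ▸ hR.boundingNum_le⟩

end Cv

theorem isLowerSet_nullIdeal : IsLowerSet nullIdeal :=
  fun _ _ hBA hA => measure_mono_null hBA hA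

theorem dominatingNum_aLc (C : ℕ → Type u) (h : ℕ → ℕ) : (aLc C h).dominatingNum = vExists C h :=
  rfl

theorem boundingNum_aLc (C : ℕ → Type u) (h : ℕ → ℕ) : (aLc C h).boundingNum = cExists C h :=
  rfl

theorem infinitePi_uniformOfFintype_eq_uniformOn (ι α : Type*) [Finite ι] [Fintype α] [Nonempty α]
    [MeasurableSpace α] [MeasurableSingletonClass α] :
    Measure.infinitePi (fun _ : ι => (PMF.uniformOfFintype α).toMeasure) =
      uniformOn (Set.univ : Set (ι → α)) := by
  classical
  have := Fintype.ofFinite ι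
  have huniform : (PMF.uniformOfFintype α).toMeasure = uniformOn Set.univ := by
    ext s hs
    rw [PMF.toMeasure_uniformOfFintype_apply s hs, uniformOn_univ, Measure.count_apply hs,
      Set.encard_eq_coe_toFinset_card, Set.toFinset_card, ENat.toENNReal_coe]
  rw [Measure.infinitePi_eq_pi, ← Set.pi_univ Set.univ, uniformOn_pi, huniform]

theorem measure_eventually_notMem_eq_zero {Ω : Type*} [MeasurableSpace Ω] {μ : Measure Ω}
    {s : ℕ → Set Ω} (hsm : ∀ i, MeasurableSet (s i)) (hs : iIndepSet s μ)
    (hsum : ∑' i, μ (s i) = ∞) : μ {ω | ∀ᶠ i in atTop, ω ∉ s i} = 0 := by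
  have := hs.isProbabilityMeasure
  have hcompl : {ω | ∀ᶠ i in atTop, ω ∉ s i} = (limsup s atTop)ᶜ := by
    ext ω
    simp only [Set.mem_ofPred_eq, Set.mem_compl_iff, mem_limsup_iff_frequently_mem, not_frequently]
  rw [hcompl, prob_compl_eq_zero_iff (.measurableSet_limsup hsm)]
  exact measure_limsup_eq_one hsm hs hsum

section Blocks

variable (k : ℕ → ℕ)

/-- The `i`-th of countably many pairwise disjoint finite blocks of coordinates of a point `x` of
`2^ω`; it has length `k i`, and its `j`-th entry is the coordinate of `x` coding the pair
`⟨i, j⟩`. -/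
def block (i : ℕ) (x : ℕ → Bool) : Fin (k i) → Bool :=
  fun j => x (Encodable.encode (⟨i, j⟩ : Σ i, Fin (k i)))

theorem measurable_block (i : ℕ) : Measurable (block k i) := by
  unfold block
  fun_prop

theorem hasLaw_block (i : ℕ) : HasLaw (block k i) (uniformOn Set.univ) cantorMeasure where
  aemeasurable := (measurable_block k i).aemeasurable
  map_eq := (Measure.map_infinitePi_infinitePi_of_inj
    (f := fun j : Fin (k i) => Encodable.encode (⟨i, j⟩ : Σ i, Fin (k i)))
    (Encodable.encode_injective.comp sigma_mk_injective)).trans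
      (infinitePi_uniformOfFintype_eq_uniformOn (Fin (k i)) Bool)

theorem iIndepFun_block : iIndepFun (block k) cantorMeasure := by
  have : IsProbabilityMeasure cantorMeasure := by unfold cantorMeasure; infer_instance
  let coin : Measure Bool := (PMF.uniformOfFintype Bool).toMeasure
  let tosses : (ℕ → Bool) → (Σ i, Fin (k i)) → Bool := fun x p => x (Encodable.encode p)
  have htosses : cantorMeasure.map tosses = Measure.infinitePi fun _ => coin :=
    Measure.map_infinitePi_infinitePi_of_inj Encodable.encode_injective
  let curry := MeasurableEquiv.piCurry fun (i : ℕ) (_ : Fin (k i)) => Bool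
  have hblock : (fun x i => block k i x) = curry ∘ tosses := rfl
  have hmeas : Measurable fun x i => block k i x := measurable_pi_lambda _ (measurable_block k)
  refine (iIndepFun_iff_hasLaw_Pi_infinitePi (hasLaw_block k) hmeas.aemeasurable).2
    ⟨hmeas.aemeasurable, ?_⟩
  rw [hblock, ← Measure.map_map curry.measurable (by fun_prop), htosses,
    Measure.infinitePi_map_piCurry fun (i : ℕ) (_ : Fin (k i)) => coin]
  simp only [coin, infinitePi_uniformOfFintype_eq_uniformOn]

variable {k} {B : ∀ i, Set (Fin (k i) → Bool)}

theorem cantorMeasure_block_mem (i : ℕ) (s : Set (Fin (k i) → Bool)) :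
    cantorMeasure {x | block k i x ∈ s} = uniformOn Set.univ s :=
  (hasLaw_block k i).measure_eq s.toFinite.measurableSet

theorem cantorMeasure_frequently_block_mem_eq_zero
    (hB : ∑' i, uniformOn Set.univ (B i) ≠ ∞) :
    cantorMeasure {x | ∃ᶠ i in atTop, block k i x ∈ B i} = 0 :=
  measure_setOfPred_frequently_eq_zero (by simpa only [cantorMeasure_block_mem] using hB)

theorem cantorMeasure_eventually_block_notMem_eq_zero
    (hB : ∑' i, uniformOn Set.univ (B i) = ∞) :
    cantorMeasure {x | ∀ᶠ i in atTop, block k i x ∉ B i} = 0 := by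
  have hBm : ∀ i, MeasurableSet (B i) := fun i => (B i).toFinite.measurableSet
  have hpre : ∀ i, MeasurableSet (block k i ⁻¹' B i) := fun i => measurable_block k i (hBm i)
  have hindep : iIndepSet (fun i => block k i ⁻¹' B i) cantorMeasure :=
    (iIndepSet_iff_meas_biInter hpre).2 fun t =>
      (iIndepFun_block k).measure_inter_preimage_eq_mul t fun i _ => hBm i
  exact measure_eventually_notMem_eq_zero hpre hindep
    ((tsum_congr fun i => cantorMeasure_block_mem i (B i)).trans hB)

end Blocks

theorem exists_balanced_map {α β : Type*} [Fintype α] [Fintype β] [Nonempty β] [DecidableEq β]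
    (hβα : Fintype.card β ≤ Fintype.card α) :
    ∃ e : α → β, ∀ b, Fintype.card β * Finset.card {a | e a = b} ≤ 2 * Fintype.card α ∧
      Fintype.card α ≤ 2 * (Fintype.card β * Finset.card {a | e a = b}) := by
  set c := Fintype.card β
  set N := Fintype.card α
  have hc : 0 < c := Fintype.card_pos
  let f : α ≃ Fin N := Fintype.equivFin α
  let g : β ≃ Fin c := Fintype.equivFin β
  refine ⟨fun a => g.symm ⟨f a % c, Nat.mod_lt _ hc⟩, fun b => ?_⟩
  have hfib : Finset.card {a | g.symm ⟨f a % c, Nat.mod_lt _ hc⟩ = b} =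
      N.count (· ≡ g b [MOD c]) := by
    simp only [Equiv.symm_apply_eq, Fin.ext_iff, Nat.count_eq_card_filter_range, Nat.ModEq,
      Nat.mod_eq_of_lt (g b).isLt, Finset.card_filter]
    rw [f.sum_comp fun n : Fin N => if (n : ℕ) % c = g b then 1 else 0,
      Fin.sum_univ_eq_sum_range fun n => if n % c = g b then 1 else 0]
  rw [hfib, Nat.count_modEq_card _ hc]
  have hdiv := Nat.div_add_mod N c
  have hmod := Nat.mod_lt N hc
  have hle : c ≤ c * (N / c) := Nat.le_mul_of_pos_right _ (Nat.div_pos hβα hc)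
  split_ifs <;> constructor <;> simp only [mul_add, mul_one, add_zero] <;> omega

theorem natCast_div_le_mul_natCast_div {a b c d k : ℕ} (hb : b ≠ 0) (hd : d ≠ 0)
    (h : a * d ≤ k * (c * b)) : (a : ℝ≥0∞) / b ≤ k * (c / d) := by
  have hb' : (b : ℝ≥0∞) ≠ 0 := by exact_mod_cast hb
  have hd' : (d : ℝ≥0∞) ≠ 0 := by exact_mod_cast hd
  rw [ENNReal.div_le_iff hb' (ENNReal.natCast_ne_top b), ← mul_div_assoc,
    ← ENNReal.mul_div_right_comm, ENNReal.le_div_iff_mul_le (.inl hd') (.inl (by simp)), mul_assoc]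
  exact_mod_cast h

theorem exists_nearly_uniform_map (β : Type*) [Fintype β] [Nonempty β] :
    ∃ (m : ℕ) (e : (Fin m → Bool) → β), ∀ s : Finset β,
      uniformOn Set.univ (e ⁻¹' s) ≤ 2 * (s.card / Fintype.card β) ∧
      (s.card : ℝ≥0∞) / Fintype.card β ≤ 2 * uniformOn Set.univ (e ⁻¹' s) := by
  have := Classical.decEq β
  set c := Fintype.card β
  obtain ⟨e, he⟩ := exists_balanced_map (α := Fin c → Bool) (β := β)
    (by simpa using Nat.lt_two_pow_self.le)
  set N := Fintype.card (Fin c → Bool)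
  refine ⟨c, e, fun s => ?_⟩
  have hpre : uniformOn Set.univ (e ⁻¹' s) = (Finset.card {a | e a ∈ s} : ℝ≥0∞) / N := by
    rw [uniformOn_univ, ← Measure.count_apply_finset]
    congr
    ext
    simp
  have hsum : c * Finset.card {a | e a ∈ s} = ∑ b ∈ s, c * Finset.card {a | e a = b} := by
    rw [← Finset.mul_sum, Finset.sum_card_fiberwise_eq_card_filter]
  have hupper : c * Finset.card {a | e a ∈ s} ≤ s.card * (2 * N) :=
    hsum.trans_le (Finset.sum_le_card_nsmul s _ _ fun b _ => (he b).1)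
  have hlower : s.card * N ≤ 2 * (c * Finset.card {a | e a ∈ s}) := by
    rw [hsum, Finset.mul_sum]
    exact Finset.card_nsmul_le_sum s _ _ fun b _ => (he b).2
  have hc : c ≠ 0 := Fintype.card_ne_zero
  have hN : N ≠ 0 := Fintype.card_ne_zero
  rw [hpre]
  exact ⟨natCast_div_le_mul_natCast_div hN hc (by linarith),
    natCast_div_le_mul_natCast_div hc hN (by linarith)⟩

theorem exists_regular_finset_family (α : Type*) [Fintype α] [Nonempty α] [DecidableEq α] {n : ℕ}
    (hn : n ≤ Fintype.card α) :
    ∃ S : α → Finset α, (∀ r, (S r).card = n) ∧ ∀ a, Finset.card {r | a ∈ S r} = n := by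
  -- The translates of a set of size `n` under a group structure on `α`.
  let _ : AddCommGroup α := (Fintype.equivFin α).addCommGroup
  obtain ⟨A, -, hA⟩ := Finset.exists_subset_card_eq (s := (Finset.univ : Finset α)) hn
  refine ⟨fun r => {a | a - r ∈ A}, fun r => ?_, fun a => ?_⟩
  · rw [← hA]
    exact Finset.card_equiv (Equiv.subRight r) fun _ => by simp
  · rw [← hA]
    exact Finset.card_equiv (Equiv.subLeft a) fun _ => by simp

theorem exists_finset_div_card_le (α : Type*) [Nonempty α] (n : ℕ) {ε : ℝ≥0∞} (hε : ε ≠ 0) :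
    ∃ t : Finset α, t.Nonempty ∧ (n : ℝ≥0∞) / t.card ≤ n / ENat.card α + ε := by
  cases finite_or_infinite α
  · have := Fintype.ofFinite α
    exact ⟨Finset.univ, Finset.univ_nonempty, by simp⟩
  · obtain ⟨m, hm⟩ := ENNReal.exists_nat_gt (ENNReal.div_ne_top (ENNReal.natCast_ne_top n) hε)
    obtain ⟨t, ht⟩ := Infinite.exists_subset_card_eq α m
    have hm0 : (m : ℝ≥0∞) ≠ 0 := (bot_le.trans_lt hm).ne'
    refine ⟨t, Finset.card_ne_zero.1 (ht ▸ Nat.cast_ne_zero.1 hm0), ?_⟩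
    have hnm : (n : ℝ≥0∞) ≤ m * ε := (ENNReal.div_le_iff_le_mul (.inl hε) (.inr hm0)).1 hm.le
    calc (n : ℝ≥0∞) / t.card ≤ ε := ht ▸ ENNReal.div_le_of_le_mul' hnm
      _ ≤ n / ENat.card α + ε := le_add_self

theorem exists_sparse_map (α : Type*) [Nonempty α] (n : ℕ) {ε : ℝ≥0∞} (hε : ε ≠ 0) :
    ∃ (m : ℕ) (e : (Fin m → Bool) → α), ∀ s : Finset α, s.card ≤ n →
      uniformOn Set.univ (e ⁻¹' s) ≤ 2 * (n / ENat.card α + ε) := by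
  classical
  obtain ⟨t, ht, htn⟩ := exists_finset_div_card_le α n hε
  have := ht.to_subtype
  obtain ⟨m, e, he⟩ := exists_nearly_uniform_map t
  refine ⟨m, fun x => e x, fun s hs => ?_⟩
  have hpre : (fun x => (e x : α)) ⁻¹' s = e ⁻¹' (s.subtype (· ∈ t)) := by
    ext
    simp
  calc uniformOn Set.univ ((fun x => (e x : α)) ⁻¹' s)
      ≤ 2 * ((s.subtype (· ∈ t)).card / Fintype.card t) := hpre ▸ (he _).1
    _ ≤ 2 * (n / t.card) := by
      rw [Fintype.card_coe]
      gcongr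
      exact (Finset.card_subtype _ s).trans_le (Finset.card_filter_le _ _) |>.trans hs
    _ ≤ 2 * (n / ENat.card α + ε) := by gcongr

theorem exists_covering_map (α : Type*) (n : ℕ) :
    ∃ (m : ℕ) (S : (Fin m → Bool) → {s : Finset α // s.card ≤ n}), ∀ a,
      min ((n : ℝ≥0∞) / ENat.card α) 1 ≤ 2 * uniformOn Set.univ {x | a ∈ (S x).1} := by
  classical
  rcases isEmpty_or_nonempty α with _ | _
  · exact ⟨0, fun _ => ⟨∅, by simp⟩, isEmptyElim⟩
  cases fintypeOrInfinite α
  · obtain ⟨S, hS, hmem⟩ := exists_regular_finset_family α (min_le_right n (Fintype.card α))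
    obtain ⟨m, e, he⟩ := exists_nearly_uniform_map α
    refine ⟨m, fun x => ⟨S (e x), (hS _).trans_le (min_le_left _ _)⟩, fun a => ?_⟩
    have hc : (Fintype.card α : ℝ≥0∞) ≠ 0 := by simp
    have hdiv : Monotone fun t : ℝ≥0∞ => t / Fintype.card α :=
      fun _ _ hst => ENNReal.div_le_div_right hst _
    calc min ((n : ℝ≥0∞) / ENat.card α) 1
        = (Finset.card {r | a ∈ S r} : ℝ≥0∞) / Fintype.card α := by
          rw [hmem, ENat.card_eq_coe_fintype_card, ENat.toENNReal_coe, Nat.mono_cast.map_min,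
            hdiv.map_min, ENNReal.div_self hc (ENNReal.natCast_ne_top _)]
      _ ≤ 2 * uniformOn Set.univ (e ⁻¹' ({r | a ∈ S r} : Finset α)) := (he _).2
      _ = 2 * uniformOn Set.univ {x | a ∈ S (e x)} :=
        congrArg (2 * uniformOn Set.univ ·) (by ext; simp)
  · exact ⟨0, fun _ => ⟨∅, by simp⟩, fun a => by simp⟩

theorem tsum_min_one_eq_top {ι : Type*} {f : ι → ℝ≥0∞} (hf : ∑' i, f i = ∞) (hfin : ∀ i, f i ≠ ∞) :
    ∑' i, min (f i) 1 = ∞ := by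
  by_contra hmin
  have hlarge : {i | 1 ≤ min (f i) 1}.Finite :=
    ENNReal.finite_const_le_of_tsum_ne_top hmin one_ne_zero
  have hle (i : ι) : f i ≤ Set.indicator {i | 1 ≤ min (f i) 1} f i + min (f i) 1 := by
    by_cases hi : 1 ≤ f i
    · simp [hi]
    · simp [hi, (not_le.1 hi).le]
  refine (ENNReal.tsum_le_tsum hle).not_gt ?_
  rw [hf, ENNReal.tsum_add, ← tsum_subtype, lt_top_iff_ne_top, ENNReal.add_ne_top]
  refine ⟨?_, hmin⟩
  have := hlarge.fintype
  rw [tsum_fintype]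
  exact ENNReal.sum_ne_top.2 fun i _ => hfin i

theorem cv_nullIdeal_tukeyLE_aLc_dual (C : ℕ → Type u) [∀ i, Nonempty (C i)] {h : ℕ → ℕ}
    (hsum : ∑' i, (h i : ℝ≥0∞) / ENat.card (C i) < ∞) :
    RelSystem.TukeyLE (Cv nullIdeal) (aLc C h).dual := by
  obtain ⟨ε, hε, hεsum⟩ := ENNReal.exists_pos_sum_of_countable' one_ne_zero ℕ
  choose k e he using fun i => exists_sparse_map (C i) (h i) (hε i).ne'
  have hnull (φ : Slalom C h) :
      cantorMeasure {x | ∃ᶠ i in atTop, e i (block k i x) ∈ (φ i).1} = 0 := by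
    refine cantorMeasure_frequently_block_mem_eq_zero (B := fun i => e i ⁻¹' (φ i).1)
      (ne_top_of_le_ne_top ?_ (ENNReal.tsum_le_tsum fun i => he i (φ i).1 (φ i).2))
    rw [ENNReal.tsum_mul_left, ENNReal.tsum_add]
    exact ENNReal.mul_ne_top ENNReal.ofNat_ne_top
      (ENNReal.add_ne_top.2 ⟨hsum.ne, hεsum.ne_top⟩)
  exact ⟨fun x i => e i (block k i x), fun φ => ⟨_, hnull φ⟩,
    fun _ _ hx => (not_eventually.1 hx).mono fun _ => not_not.1⟩

theorem cv_nullIdeal_tukeyLE_aLc {C : ℕ → Type u} {h : ℕ → ℕ}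
    (hsum : ∑' i, (h i : ℝ≥0∞) / ENat.card (C i) = ∞) :
    RelSystem.TukeyLE (Cv nullIdeal) (aLc C h) := by
  choose k S hS using fun i => exists_covering_map (C i) (h i)
  have hnull (y : ∀ i, C i) :
      cantorMeasure {x | ∀ᶠ i in atTop, y i ∉ (S i (block k i x)).1} = 0 := by
    refine cantorMeasure_eventually_block_notMem_eq_zero (B := fun i => {z | y i ∈ (S i z).1}) ?_
    have (i : ℕ) : Nonempty (C i) := ⟨y i⟩
    have hfin (i : ℕ) : (h i : ℝ≥0∞) / ENat.card (C i) ≠ ∞ :=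
      ENNReal.div_ne_top (ENNReal.natCast_ne_top _) (by simp)
    have htop : ∞ ≤ 2 * ∑' i, uniformOn Set.univ {z | y i ∈ (S i z).1} := by
      rw [← ENNReal.tsum_mul_left, ← tsum_min_one_eq_top hsum hfin]
      exact ENNReal.tsum_le_tsum fun i => hS i (y i)
    by_contra hne
    exact ENNReal.mul_ne_top ENNReal.ofNat_ne_top hne (top_le_iff.1 htop)
  exact ⟨fun x i => S i (block k i x), fun y => ⟨_, hnull y⟩, fun _ _ => id⟩

theorem lemma2p3_general (C : ℕ → Type) [∀ i, Nonempty (C i)] (h : ℕ → ℕ) :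
    (∑' i, (h i : ℝ≥0∞) / ENat.card (C i) < ∞ →
      RelSystem.TukeyLE (Cv nullIdeal) (aLc C h).dual ∧
      covNum nullIdeal ≤ cExists C h ∧
      vExists C h ≤ nonNum nullIdeal) ∧
    (∑' i, (h i : ℝ≥0∞) / ENat.card (C i) = ∞ →
      RelSystem.TukeyLE (Cv nullIdeal) (aLc C h) ∧
      covNum nullIdeal ≤ vExists C h ∧
      cExists C h ≤ nonNum nullIdeal) := by
  refine ⟨fun hsum => ?_, fun hsum => ?_⟩
  · have hT := cv_nullIdeal_tukeyLE_aLc_dual C hsum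
    have hcard := hT.covNum_le_and_le_nonNum isLowerSet_nullIdeal
    rw [RelSystem.dominatingNum_dual, RelSystem.boundingNum_dual, boundingNum_aLc,
      dominatingNum_aLc] at hcard
    exact ⟨hT, hcard⟩
  · have hT := cv_nullIdeal_tukeyLE_aLc hsum
    have hcard := hT.covNum_le_and_le_nonNum isLowerSet_nullIdeal
    rw [dominatingNum_aLc, boundingNum_aLc] at hcard
    exact ⟨hT, hcard⟩

theorem lemma2p3 (c h : ℕ → ℕ) (hc : ∀ i, 1 ≤ c i) (hh : ∀ᶠ i in atTop, 1 ≤ h i) :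
    (∑' i, (h i : ℝ≥0∞) / (c i : ℝ≥0∞) < ∞ →
      RelSystem.TukeyLE (Cv nullIdeal) (aLc (finSeq c) h).dual ∧
      covNum nullIdeal ≤ cExists (finSeq c) h ∧
      vExists (finSeq c) h ≤ nonNum nullIdeal) ∧
    (∑' i, (h i : ℝ≥0∞) / (c i : ℝ≥0∞) = ∞ →
      RelSystem.TukeyLE (Cv nullIdeal) (aLc (finSeq c) h) ∧
      covNum nullIdeal ≤ vExists (finSeq c) h ∧
      cExists (finSeq c) h ≤ nonNum nullIdeal) := by
  have (i : ℕ) : NeZero (c i) := ⟨Nat.one_le_iff_ne_zero.1 (hc i)⟩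
  simpa using lemma2p3_general (finSeq c) h
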